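/- Let $\mathbb{K}=\mathbb{R}$ or $\mathbb{C}$, let $\Omega\subset\mathbb{R}^d$ be a bounded open set, $V:\mathbb{R}^d\to\mathbb{R}$ a real potential, and let $\hat H=-\tfrac12\Delta+V$ be the Hamiltonian on $L^2(\Omega;\mathbb{K})$ with boundary conditions that make it a self-adjoint operator with compact resolvent (that is, $\hat H$ is a self-adjoint operator with compact resolvent on a dense domain $D(\hat H)\subset L^2(\Omega)$ such that, for every $u\in D(\hat H)$, $Vu$ is locally integrable on $\Omega$ and $\hat Hu=-\tfrac12\Delta u+Vu$ in the sense of distributions on $\Omega$). Let $\phi_1,\phi_2,\dots$ be orthonormal eigenfunctions of $\hat H$ with eigenvalues $\lambda_1\le\lambda_2\le\cdots$, where all eigenvalues are listed with multiplicity. For $u$ in the form domain of $\hat H$ (the domain of the closure of the quadratic form $u\mapsto\langle u,\hat Hu\rangle$ on $D(\hat H)$), let $\langle u,\hat Hu\rangle$ denote the value of the closed form. Fix a set $\mathcal{D}$ of admissible functions that contains $D(\hat H)$ and is contained in the form domain (for example, either of these two), and let $N\ge1$ be such that $\lambda_{N+1}>\lambda_N$. Let $J:L^2(\Omega)\to\mathbb{R}$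 satisfy $0\le J(g)\le C\|g\|_2$ for all $g\in L^2(\Omega)$, with some constant $C$. Then for every $\epsilon>0$ there is $\mu_0>0$ such that for every $\mu>\mu_0$ and every solution $f_1,\dots,f_N$ of the problem $$\min\ \sum_{i=1}^N\Big(\frac1\mu J(\tilde f_i)+\langle \tilde f_i,\hat H\tilde f_i\rangle\Big)\quad\text{over } \tilde f_1,\dots,\tilde f_N\in\mathcal{D}\ \text{ with }\ \langle\tilde f_j,\tilde f_k\rangle=\delta_{jk},$$ there is a unitary matrix $U\in\mathbb{K}^{N\times N}$ (orthogonal if $\mathbb{K}=\mathbb{R}$) such that $\varphi_i=\sum_{k=1}^N U_{ik}\phi_k$ satisfies $\|f_i-\varphi_i\|_2<\epsilon$ for $i=1,\dots,N$. Moreover, $J(g)=\|g\|_1=\int_\Omega|g|\,dx$ satisfies the condition on $J$; in this case the solutions $f_1,\dots,f_N$ are the compressed modes. -/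

import Mathlib

open MeasureTheory Filter Topology
open scoped InnerProductSpace Distributions

namespace CompressedModes

/-- The Hilbert space `L²(Ω)` of `𝕜`-valued functions (`𝕜 = ℝ` or `ℂ`) on an open set
`Ω ⊆ ℝ^d`. -/
abbrev L2 (𝕜 : Type*) [RCLike 𝕜] {d : ℕ}
    (Ω : TopologicalSpace.Opens (EuclideanSpace ℝ (Fin d))) : Type _ :=
  Lp 𝕜 2 (volume.restrict (Ω : Set (EuclideanSpace ℝ (Fin d))))

section Operator

variable {𝕜 : Type*} [RCLike 𝕜]
variable {H : Type*} [NormedAddCommGroup H] [InnerProductSpace 𝕜 H]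

/-- The (possibly unbounded) operator `A` has compact resolvent: for some real `z`, the map
`A - z : D(A) → H` is a bijection whose inverse `R` is a compact operator on `H`. -/
def HasCompactResolvent (A : H →ₗ.[𝕜] H) : Prop :=
  ∃ (z : ℝ) (R : H →L[𝕜] H), IsCompactOperator R ∧
    (∀ u : A.domain, R (A u - (z : 𝕜) • (u : H)) = (u : H)) ∧
    (∀ g : H, ∃ u : A.domain, (u : H) = R g ∧ A u - (z : 𝕜) • (u : H) = g)

/-- `φ 0, φ 1, …` are orthonormal eigenvectors of `A` with eigenvalues `lam 0 ≤ lam 1 ≤ …`, and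
the list contains every eigenvalue with its full multiplicity. -/
structure IsEigenSystem (A : H →ₗ.[𝕜] H) (lam : ℕ → ℝ) (φ : ℕ → H) : Prop where
  orthonormal : Orthonormal 𝕜 φ
  monotone : Monotone lam
  eigen : ∀ k, ∃ u : A.domain, (u : H) = φ k ∧ A u = (lam k : 𝕜) • φ k
  exhaustive : ∀ (c : 𝕜) (u : A.domain), A u = c • (u : H) →
    (u : H) ∈ Submodule.span 𝕜 {v : H | ∃ k, (lam k : 𝕜) = c ∧ v = φ k}

/-- `⟨u, A u⟩` for `u` in the operator domain (a real number when `A` is symmetric). -/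
noncomputable def opForm (A : H →ₗ.[𝕜] H) (u : A.domain) : ℝ :=
  RCLike.re (inner 𝕜 (u : H) (A u))

/-- `⟨u, A u⟩ = e` in the sense of the closure of the quadratic form `u ↦ ⟨u, A u⟩` on `D(A)`:
some sequence `w n` in `D(A)` converges to `u`, is Cauchy for the form, and has
`⟨w n, A (w n)⟩ → e`. -/
def HasEnergy (A : H →ₗ.[𝕜] H) (u : H) (e : ℝ) : Prop :=
  ∃ w : ℕ → A.domain,
    Tendsto (fun n => (w n : H)) atTop (𝓝 u) ∧
    (∀ δ > (0 : ℝ), ∃ n₀ : ℕ, ∀ m ≥ n₀, ∀ n ≥ n₀, |opForm A (w m - w n)| < δ) ∧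
    Tendsto (fun n => opForm A (w n)) atTop (𝓝 e)

/-- The form domain of `A`: the vectors `u` for which the closed form `⟨u, A u⟩` is finite. -/
def formDomain (A : H →ₗ.[𝕜] H) : Set H := {u | ∃ e : ℝ, HasEnergy A u e}

/-- `f` minimizes `∑ i, ((1/μ) J (f i) + ⟨f i, A (f i)⟩)` among all orthonormal `N`-tuples of
elements of `𝒟`. -/
def IsMinimizer (A : H →ₗ.[𝕜] H) (𝒟 : Set H) (J : H → ℝ) (μ : ℝ) {N : ℕ} (f : Fin N → H) :
    Prop :=
  Orthonormal 𝕜 f ∧ (∀ i, f i ∈ 𝒟) ∧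
    ∃ e : Fin N → ℝ, (∀ i, HasEnergy A (f i) (e i)) ∧
      ∀ (g : Fin N → H) (e' : Fin N → ℝ), Orthonormal 𝕜 g → (∀ i, g i ∈ 𝒟) →
        (∀ i, HasEnergy A (g i) (e' i)) →
        ∑ i, ((1 / μ) * J (f i) + e i) ≤ ∑ i, ((1 / μ) * J (g i) + e' i)

/-- `0 ≤ J g ≤ C ‖g‖` for all `g`, with some constant `C`. -/
def IsBoundedPenalty (J : H → ℝ) : Prop :=
  ∃ C : ℝ, ∀ g : H, 0 ≤ J g ∧ J g ≤ C * ‖g‖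

end Operator

section Hamiltonian

variable {𝕜 : Type*} [RCLike 𝕜] {d : ℕ}
variable {Ω : TopologicalSpace.Opens (EuclideanSpace ℝ (Fin d))}

/-- `A` is the Hamiltonian `-½ Δ + V` on `L²(Ω)` under boundary conditions (encoded in the
domain of `A`) that make it self-adjoint with compact resolvent. The action `A u = -½ Δ u + V u`
is meant in the sense of distributions on `Ω`. -/
structure IsHamiltonian (V : EuclideanSpace ℝ (Fin d) → ℝ) (A : L2 𝕜 Ω →ₗ.[𝕜] L2 𝕜 Ω) :
    Prop where
  dense_domain : Dense (A.domain : Set (L2 𝕜 Ω))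
  selfAdjoint : IsSelfAdjoint A
  compactResolvent : HasCompactResolvent A
  potential_mul : ∀ u : A.domain,
    LocallyIntegrableOn (fun x => V x • (u : L2 𝕜 Ω) x)
      (Ω : Set (EuclideanSpace ℝ (Fin d))) volume
  apply_eq : ∀ (u : A.domain) (η : 𝓓(Ω, ℝ)),
    ∫ x in (Ω : Set (EuclideanSpace ℝ (Fin d))), η x • (A u : L2 𝕜 Ω) x =
      -(1 / 2 : ℝ) • (∫ x in (Ω : Set (EuclideanSpace ℝ (Fin d))),
        (Laplacian.laplacian (η : EuclideanSpace ℝ (Fin d) → ℝ) x) • (u : L2 𝕜 Ω) x) +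
      ∫ x in (Ω : Set (EuclideanSpace ℝ (Fin d))), η x • (V x • (u : L2 𝕜 Ω) x)

/-- The `L¹` norm `g ↦ ∫_Ω |g|` on `L²(Ω)` (finite when `Ω` is bounded). -/
noncomputable def l1Norm (g : L2 𝕜 Ω) : ℝ :=
  ∫ x in (Ω : Set (EuclideanSpace ℝ (Fin d))), ‖g x‖

end Hamiltonian

end CompressedModes

/-! Comparing a minimizer with the lowest `N` eigenvectors, and using `J ≥ 0`, shows that its energy
exceeds the sum of their eigenvalues by at most `N * C / μ`. In the eigenbasis, mass of an
orthonormal tuple outside the span of these eigenvectors costs at least the gap `lam N - lam (N -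
1)` per unit, so the total mass outside tends to zero as `μ → ∞` (`gap_mul_defect_le`). The matrix
of coefficients in that span is then nearly unitary, and compactness provides a unitary matrix close
to it (`exists_unitary_near_of_defect`). -/

namespace CompressedModes

/-! ### Eigenvector expansion and the energy gap. -/

section SpectralTheory

variable {𝕜 : Type*} [RCLike 𝕜]
variable {H : Type*} [NormedAddCommGroup H] [InnerProductSpace 𝕜 H] [CompleteSpace H]

/-- A self-adjoint operator is symmetric. -/
theorem inner_apply_left_of_isSelfAdjoint {A : H →ₗ.[𝕜] H} (hA : IsSelfAdjoint A)
    (u v : A.domain) : inner 𝕜 (A u) (v : H) = inner 𝕜 (u : H) (A v) := by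
  have h := LinearPMap.adjoint_isFormalAdjoint hA.dense_domain
  rw [LinearPMap.isSelfAdjoint_def.mp hA] at h
  exact h u v

/-- The eigenvectors of a self-adjoint operator with compact resolvent are complete. -/
theorem IsEigenSystem.orthogonal_span_eq_bot {A : H →ₗ.[𝕜] H} (hA : IsSelfAdjoint A)
    (hR : HasCompactResolvent A) {lam : ℕ → ℝ} {φ : ℕ → H} (hφ : IsEigenSystem A lam φ) :
    (Submodule.span 𝕜 (Set.range φ))ᗮ = ⊥ := by
  obtain ⟨z, R, hRc, hRl, hRr⟩ := hR
  have hsymm : (R : H →ₗ[𝕜] H).IsSymmetric := by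
    intro x y
    obtain ⟨u, hu, hux⟩ := hRr x
    obtain ⟨v, hv, hvy⟩ := hRr y
    have h := inner_apply_left_of_isSelfAdjoint hA u v
    change inner 𝕜 (R x) y = inner 𝕜 x (R y)
    rw [← hu, ← hv, ← hux, ← hvy, inner_sub_left, inner_sub_right, inner_smul_left,
      inner_smul_right, h, RCLike.conj_ofReal]
  -- `R` inverts `A - z`: it is injective, and `R v = c • v` makes `v` an eigenvector of `A` for `z
  -- + c⁻¹`. The spectral theorem for compact symmetric operators then applies to `R`.
  have hle : (⨆ c, Module.End.eigenspace (R : H →ₗ[𝕜] H) c) ≤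
      Submodule.span 𝕜 (Set.range φ) := by
    refine iSup_le fun c v hv => ?_
    have hv : R v = c • v := Module.End.mem_eigenspace_iff.mp hv
    obtain ⟨u, hu, hug⟩ := hRr v
    rw [hv] at hu
    by_cases hc : c = 0
    · subst hc
      have hu0 : u = 0 := Subtype.ext (by simpa using hu)
      rw [hu0] at hug
      have : v = 0 := by simpa using hug.symm
      rw [this]
      exact Submodule.zero_mem _
    · have hv' : v = c⁻¹ • (u : H) := by rw [hu, inv_smul_smul₀ hc]
      have hAu : A u = ((z : 𝕜) + c⁻¹) • (u : H) := by
        rw [add_smul, ← hv', ← hug]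
        abel
      have hmem := hφ.exhaustive _ u hAu
      rw [hv']
      refine Submodule.smul_mem _ _ (Submodule.span_mono ?_ hmem)
      rintro w ⟨k, -, rfl⟩
      exact ⟨k, rfl⟩
  have hbot := ContinuousLinearMap.orthogonalComplement_iSup_eigenspaces_eq_bot hRc hsymm
  exact le_bot_iff.mp (hbot ▸ Submodule.orthogonal_le hle)

/-- On the operator domain, the quadratic form is diagonal in the eigenvectors. -/
theorem IsEigenSystem.hasSum_opForm {A : H →ₗ.[𝕜] H} (hA : IsSelfAdjoint A)
    (hR : HasCompactResolvent A) {lam : ℕ → ℝ} {φ : ℕ → H} (hφ : IsEigenSystem A lam φ)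
    (c : ℝ) (u : A.domain) :
    HasSum (fun k => (lam k - c) * ‖inner 𝕜 (φ k) (u : H)‖ ^ 2)
      (opForm A u - c * ‖(u : H)‖ ^ 2) := by
  let b := HilbertBasis.mkOfOrthogonalEqBot hφ.orthonormal (hφ.orthogonal_span_eq_bot hA hR)
  have hb : ⇑b = φ := HilbertBasis.coe_mkOfOrthogonalEqBot _ _
  -- Real part of Parseval's identity for `u` and `(A - c) u`.
  have h := (b.hasSum_inner_mul_inner (u : H) (A u - (c : 𝕜) • (u : H))).mapL
    (RCLike.reCLM (K := 𝕜))
  rw [hb] at h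
  convert! h using 1
  · funext k
    obtain ⟨v, hv, hAv⟩ := hφ.eigen k
    have h1 : inner 𝕜 (φ k) (A u) = (lam k : 𝕜) * inner 𝕜 (φ k) (u : H) := by
      rw [← hv, ← inner_apply_left_of_isSelfAdjoint hA, hAv, inner_smul_left, hv,
        RCLike.conj_ofReal]
    have h2 : inner 𝕜 (u : H) (φ k) * inner 𝕜 (φ k) (A u - (c : 𝕜) • (u : H)) =
        (((lam k - c) * ‖inner 𝕜 (φ k) (u : H)‖ ^ 2 : ℝ) : 𝕜) := by
      rw [inner_sub_right, inner_smul_right, h1, ← inner_conj_symm (u : H) (φ k), ← sub_mul,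
        mul_left_comm, RCLike.conj_mul]
      push_cast
      rfl
    rw [h2]
    simp
  · rw [inner_sub_right, inner_smul_right, inner_self_eq_norm_sq_to_K]
    have h3 : (c : 𝕜) * (‖(u : H)‖ : 𝕜) ^ 2 = ((c * ‖(u : H)‖ ^ 2 : ℝ) : 𝕜) := by
      push_cast
      rfl
    rw [h3]
    simp [opForm]

/-- The closed form dominates the truncation of its diagonalization in which all eigenvalues from
the `N`-th on are replaced by the `N`-th. -/
theorem IsEigenSystem.sum_le_of_hasEnergy {A : H →ₗ.[𝕜] H} (hA : IsSelfAdjoint A)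
    (hR : HasCompactResolvent A) {lam : ℕ → ℝ} {φ : ℕ → H} (hφ : IsEigenSystem A lam φ)
    (N : ℕ) {u : H} {e : ℝ} (hu : HasEnergy A u e) :
    ∑ k : Fin N, (lam k - lam N) * ‖inner 𝕜 (φ k) u‖ ^ 2 ≤ e - lam N * ‖u‖ ^ 2 := by
  obtain ⟨w, hw, -, he⟩ := hu
  have hL : Tendsto (fun n => ∑ k : Fin N, (lam k - lam N) * ‖inner 𝕜 (φ k) (w n : H)‖ ^ 2) atTop
      (𝓝 (∑ k : Fin N, (lam k - lam N) * ‖inner 𝕜 (φ k) u‖ ^ 2)) :=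
    tendsto_finsetSum _ fun k _ =>
      ((tendsto_const_nhds.inner hw).norm.pow 2).const_mul _
  -- The finite sum is norm continuous, so the bound need only hold on the operator domain. There,
  -- the shift by `lam N` makes the discarded terms `k ≥ N` nonnegative.
  refine le_of_tendsto_of_tendsto' hL (he.sub ((hw.norm.pow 2).const_mul _)) fun n => ?_
  rw [Fin.sum_univ_eq_sum_range (fun k => (lam k - lam N) * ‖inner 𝕜 (φ k) (w n : H)‖ ^ 2) N]
  refine sum_le_hasSum _ (fun k hk => ?_) (hφ.hasSum_opForm hA hR (lam N) (w n))
  have hk : N ≤ k := by simpa using hk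
  exact mul_nonneg (sub_nonneg.mpr (hφ.monotone hk)) (sq_nonneg _)

/-- The defect `N - ∑ |⟨φ k, f i⟩|²` of an orthonormal `N`-tuple is controlled by its excess
energy over the sum of the lowest `N` eigenvalues. -/
theorem IsEigenSystem.gap_mul_defect_le {A : H →ₗ.[𝕜] H} (hA : IsSelfAdjoint A)
    (hR : HasCompactResolvent A) {lam : ℕ → ℝ} {φ : ℕ → H} (hφ : IsEigenSystem A lam φ)
    {N : ℕ} {f : Fin N → H} (hf : Orthonormal 𝕜 f) {e : Fin N → ℝ}
    (he : ∀ i, HasEnergy A (f i) (e i)) :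
    (lam N - lam (N - 1)) * (N - ∑ i, ∑ k : Fin N, ‖inner 𝕜 (φ k) (f i)‖ ^ 2) ≤
      ∑ i, e i - ∑ k : Fin N, lam k := by
  have h1 : ∑ i, ∑ k : Fin N, (lam k - lam N) * ‖inner 𝕜 (φ k) (f i)‖ ^ 2 ≤
      ∑ i, (e i - lam N * ‖f i‖ ^ 2) :=
    Finset.sum_le_sum fun i _ => hφ.sum_le_of_hasEnergy hA hR N (he i)
  have h2 : ∀ k : Fin N, (lam N - lam (N - 1)) * (1 - ∑ i, ‖inner 𝕜 (φ k) (f i)‖ ^ 2) ≤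
      (lam N - lam k) * (1 - ∑ i, ‖inner 𝕜 (φ k) (f i)‖ ^ 2) := by
    intro k
    -- Bessel's inequality for the family `f`: no eigenvector can be filled by more than one unit of
    -- mass.
    have hbessel : ∑ i, ‖inner 𝕜 (f i) (φ k)‖ ^ 2 ≤ ‖φ k‖ ^ 2 :=
      hf.sum_inner_products_le (φ k)
    simp only [norm_inner_symm (f _), hφ.orthonormal.1 k, one_pow] at hbessel
    have hmono : lam k ≤ lam (N - 1) := hφ.monotone (by omega)
    exact mul_le_mul_of_nonneg_right (by linarith) (by linarith)
  have h3 := Finset.sum_le_sum fun k (_ : k ∈ Finset.univ) => h2 k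
  rw [Finset.sum_comm] at h1 ⊢
  simp only [hf.1, ← Finset.mul_sum, Finset.sum_sub_distrib, Finset.sum_const, Finset.card_univ,
    Fintype.card_fin, nsmul_eq_mul, mul_one, one_pow, sub_mul, mul_sub] at h1 h3 ⊢
  linarith

end SpectralTheory

/-! ### Nearly unitary matrices and nearly aligned orthonormal families. -/

section UnitaryApproximation

variable {𝕜 : Type*} [RCLike 𝕜]

/-- A bounded square matrix that is nearly unitary is close to a unitary matrix. -/
theorem exists_unitary_near (n : Type*) [Fintype n] [DecidableEq n] {η : ℝ} (hη : 0 < η) :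
    ∃ δ > (0 : ℝ), ∀ M : Matrix n n 𝕜, (∀ i j, ‖M i j‖ ≤ 1) →
      (∀ i j, ‖(M * star M - 1) i j‖ < δ) →
        ∃ U ∈ Matrix.unitaryGroup n 𝕜, ∀ i j, ‖M i j - U i j‖ < η := by
  -- `K` is the compact set of bounded matrices that are not `η`-close to any unitary one; the
  -- unitarity defect `F` has a positive minimum there.
  let K : Set (Matrix n n 𝕜) :=
    (Set.univ.pi fun _ => Set.univ.pi fun _ => Metric.closedBall (0 : 𝕜) 1) \
      ⋃ U ∈ Matrix.unitaryGroup n 𝕜, ⋂ i, ⋂ j, {M | ‖M i j - U i j‖ < η}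
  have hK : IsCompact K := by
    refine IsCompact.diff
      (isCompact_univ_pi fun _ => isCompact_univ_pi fun _ => isCompact_closedBall 0 1) ?_
    refine isOpen_biUnion fun U _ => isOpen_iInter_of_finite fun i =>
      isOpen_iInter_of_finite fun j => isOpen_lt ?_ continuous_const
    exact ((continuous_id.matrix_elem i j).sub continuous_const).norm
  let F : Matrix n n 𝕜 → ℝ := fun M => ∑ i, ∑ j, ‖(M * star M - 1) i j‖
  have hF : Continuous F := by
    refine continuous_finsetSum _ fun i _ => continuous_finsetSum _ fun j _ => ?_
    have h : Continuous fun M : Matrix n n 𝕜 => M * star M - 1 :=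
      (continuous_id.matrix_mul continuous_id.matrix_conjTranspose).sub continuous_const
    exact (h.matrix_elem i j).norm
  have hpos : ∀ M ∈ K, 0 < F M := by
    intro M hM
    refine lt_of_le_of_ne
      (Finset.sum_nonneg fun i _ => Finset.sum_nonneg fun j _ => norm_nonneg _) fun h0 => ?_
    have hU : M * star M = 1 := by
      ext i j
      have h1 := (Finset.sum_eq_zero_iff_of_nonneg fun i _ =>
        Finset.sum_nonneg fun j _ => norm_nonneg ((M * star M - 1) i j)).mp h0.symm i
          (Finset.mem_univ i)
      have h2 := (Finset.sum_eq_zero_iff_of_nonneg fun j _ =>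
        norm_nonneg ((M * star M - 1) i j)).mp h1 j (Finset.mem_univ j)
      rw [norm_eq_zero, Matrix.sub_apply, sub_eq_zero] at h2
      exact h2
    refine hM.2 (Set.mem_iUnion₂.mpr ⟨M, Matrix.mem_unitaryGroup_iff.mpr hU, ?_⟩)
    simp [hη]
  obtain ⟨m, hm, hmF⟩ : ∃ m > (0 : ℝ), ∀ M ∈ K, m ≤ F M := by
    rcases K.eq_empty_or_nonempty with h | h
    · exact ⟨1, one_pos, by simp [h]⟩
    · obtain ⟨M₀, hM₀, hmin⟩ := hK.exists_isMinOn h hF.continuousOn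
      exact ⟨F M₀, hpos M₀ hM₀, fun M hM => hmin hM⟩
  have hc : (0 : ℝ) < (Fintype.card n : ℝ) * Fintype.card n + 1 := by positivity
  -- The `+ 1` keeps the sum of all entry bounds strictly below `m` and covers empty `n`.
  refine ⟨m / (Fintype.card n * Fintype.card n + 1), div_pos hm hc, fun M hM1 hM2 => ?_⟩
  by_contra hcon
  have hMK : M ∈ K := by
    refine ⟨fun i _ j _ => by simpa using hM1 i j, fun hmem => hcon ?_⟩
    obtain ⟨U, hU, hMU⟩ := Set.mem_iUnion₂.mp hmem
    exact ⟨U, hU, by simpa using hMU⟩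
  have h1 : F M ≤ ∑ _i : n, ∑ _j : n, m / (Fintype.card n * Fintype.card n + 1) :=
    Finset.sum_le_sum fun i _ => Finset.sum_le_sum fun j _ => (hM2 i j).le
  have h2 := hmF M hMK
  simp only [Finset.sum_const, Finset.card_univ, nsmul_eq_mul] at h1
  have h3 : (Fintype.card n : ℝ) * (Fintype.card n * (m / (Fintype.card n * Fintype.card n + 1)))
      < m := by
    rw [← mul_assoc, mul_div_assoc', div_lt_iff₀ hc]
    nlinarith
  linarith

variable {H : Type*} [NormedAddCommGroup H] [InnerProductSpace 𝕜 H]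

/-- The Gram matrix of the components of `f` orthogonal to an orthonormal family `φ`. -/
theorem inner_sub_sum_sub_sum {ι κ : Type*} [Fintype κ] {φ : κ → H} (hφ : Orthonormal 𝕜 φ)
    (f : ι → H) (i j : ι) :
    inner 𝕜 (f j - ∑ k, inner 𝕜 (φ k) (f j) • φ k) (f i - ∑ k, inner 𝕜 (φ k) (f i) • φ k) =
      inner 𝕜 (f j) (f i) - ∑ k, inner 𝕜 (φ k) (f i) * star (inner 𝕜 (φ k) (f j)) := by
  classical
  have h1 : inner 𝕜 (∑ k, inner 𝕜 (φ k) (f j) • φ k)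
      (f i - ∑ k, inner 𝕜 (φ k) (f i) • φ k) = 0 := by
    rw [sum_inner]
    refine Finset.sum_eq_zero fun k _ => ?_
    rw [inner_smul_left, inner_sub_right, hφ.inner_right_fintype, sub_self, mul_zero]
  rw [inner_sub_left, h1, sub_zero, inner_sub_right, inner_sum]
  congr 1
  refine Finset.sum_congr rfl fun k _ => ?_
  rw [inner_smul_right, ← inner_conj_symm (f j) (φ k)]
  rfl

/-- An orthonormal family that nearly lies in the span of an orthonormal family of the same size
is close to a unitary transform of it. -/
theorem exists_unitary_near_of_defect (𝕜 : Type*) [RCLike 𝕜] (H : Type*) [NormedAddCommGroup H]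
    [InnerProductSpace 𝕜 H] (n : Type*) [Fintype n] [DecidableEq n] {ε : ℝ} (hε : 0 < ε) :
    ∃ δ > (0 : ℝ), ∀ φ f : n → H, Orthonormal 𝕜 φ → Orthonormal 𝕜 f →
      Fintype.card n - ∑ i, ∑ k, ‖inner 𝕜 (φ k) (f i)‖ ^ 2 < δ →
        ∃ U ∈ Matrix.unitaryGroup n 𝕜, ∀ i, ‖f i - ∑ k, U i k • φ k‖ < ε := by
  have hc : (0 : ℝ) < (Fintype.card n : ℝ) + 1 := by positivity
  obtain ⟨δ, hδ, hU⟩ := exists_unitary_near (𝕜 := 𝕜) n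
    (show (0 : ℝ) < ε / 2 / (Fintype.card n + 1) by positivity)
  -- `δ` serves the coefficient matrix, `(ε / 2) ^ 2` the residuals `Q i` orthogonal to the span of
  -- `φ`.
  refine ⟨min δ ((ε / 2) ^ 2), by positivity, fun φ f hφ hf hdef => ?_⟩
  let Q : n → H := fun i => f i - ∑ k, inner 𝕜 (φ k) (f i) • φ k
  have hQ : ∀ i, ‖Q i‖ ^ 2 = 1 - ∑ k, ‖inner 𝕜 (φ k) (f i)‖ ^ 2 := by
    intro i
    have h := inner_sub_sum_sub_sum hφ f i i
    rw [inner_self_eq_norm_sq_to_K, inner_self_eq_norm_sq_to_K, hf.1 i] at h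
    simp only [RCLike.star_def, RCLike.mul_conj] at h
    rw [← one_pow 2]
    exact_mod_cast h
  have hQsum : ∑ i, ‖Q i‖ ^ 2 < min δ ((ε / 2) ^ 2) := by
    simpa [hQ, Finset.sum_sub_distrib] using hdef
  have hQlt : ∀ i, ‖Q i‖ ^ 2 < min δ ((ε / 2) ^ 2) := fun i =>
    (Finset.single_le_sum (f := fun i => ‖Q i‖ ^ 2) (fun j _ => sq_nonneg _)
      (Finset.mem_univ i)).trans_lt hQsum
  obtain ⟨U, hUu, hUM⟩ := hU (Matrix.of fun i k => inner 𝕜 (φ k) (f i))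
    (fun i k => by
      have h := norm_inner_le_norm (𝕜 := 𝕜) (φ k) (f i)
      simpa [hφ.1 k, hf.1 i] using h)
    (fun i j => by
      have h := inner_sub_sum_sub_sum hφ f i j
      -- As `f` is orthonormal, the unitarity defect is minus the Gram matrix of the residuals, so
      -- Cauchy–Schwarz bounds its entries.
      have hent : (Matrix.of (fun i k => inner 𝕜 (φ k) (f i)) *
          star (Matrix.of fun i k => inner 𝕜 (φ k) (f i)) - 1) i j = -inner 𝕜 (Q j) (Q i) := by
        rw [h, orthonormal_iff_ite.mp hf j i, Matrix.sub_apply, Matrix.mul_apply,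
          Matrix.one_apply, neg_sub]
        simp only [eq_comm (a := j), Matrix.star_apply, Matrix.of_apply]
      rw [hent, norm_neg]
      refine (norm_inner_le_norm _ _).trans_lt ?_
      have hi := (hQlt i).trans_le (min_le_left _ _)
      have hj := (hQlt j).trans_le (min_le_left _ _)
      nlinarith [sq_nonneg (‖Q i‖ - ‖Q j‖)])
  refine ⟨U, hUu, fun i => ?_⟩
  have hsplit : f i - ∑ k, U i k • φ k = Q i + ∑ k, (inner 𝕜 (φ k) (f i) - U i k) • φ k := by
    simp only [Q, sub_smul, Finset.sum_sub_distrib]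
    abel
  have h1 : ‖Q i‖ < ε / 2 :=
    lt_of_pow_lt_pow_left₀ 2 (by positivity) ((hQlt i).trans_le (min_le_right _ _))
  have h2 : ‖∑ k, (inner 𝕜 (φ k) (f i) - U i k) • φ k‖ ≤
      ∑ _k : n, ε / 2 / (Fintype.card n + 1) := by
    refine norm_sum_le_of_le _ fun k _ => ?_
    rw [norm_smul, hφ.1 k, mul_one]
    exact (hUM i k).le
  have h3 : ∑ _k : n, ε / 2 / ((Fintype.card n : ℝ) + 1) ≤ ε / 2 := by
    rw [Finset.sum_const, Finset.card_univ, nsmul_eq_mul, mul_div_assoc', div_le_iff₀ hc]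
    nlinarith
  rw [hsplit]
  exact (norm_add_le _ _).trans_lt (by linarith)

end UnitaryApproximation

/-! ### Energy comparison and the choice of `μ₀`. -/

section Minimizers

variable {𝕜 : Type*} [RCLike 𝕜]
variable {H : Type*} [NormedAddCommGroup H] [InnerProductSpace 𝕜 H]

/-- An eigenvector has its eigenvalue as energy. -/
theorem IsEigenSystem.hasEnergy {A : H →ₗ.[𝕜] H} {lam : ℕ → ℝ} {φ : ℕ → H}
    (hφ : IsEigenSystem A lam φ) (k : ℕ) : HasEnergy A (φ k) (lam k) := by
  obtain ⟨u, hu, hAu⟩ := hφ.eigen k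
  refine ⟨fun _ => u, by simp [hu], fun δ hδ => ⟨0, fun m _ n _ => ?_⟩, ?_⟩
  · simpa [opForm] using hδ
  · have : opForm A u = lam k := by
      rw [opForm, hAu, hu, inner_smul_right, inner_self_eq_norm_sq_to_K, hφ.orthonormal.1 k]
      simp
    simp [this]

/-- Comparison with the eigenvectors bounds the energy of a minimizer. -/
theorem IsMinimizer.exists_energy_le {A : H →ₗ.[𝕜] H} {lam : ℕ → ℝ} {φ : ℕ → H}
    (hφ : IsEigenSystem A lam φ) {𝒟 : Set H} (h𝒟 : (A.domain : Set H) ⊆ 𝒟) {J : H → ℝ} {C : ℝ}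
    (hJ : ∀ g, 0 ≤ J g ∧ J g ≤ C * ‖g‖) {μ : ℝ} (hμ : 0 < μ) {N : ℕ} {f : Fin N → H}
    (hf : IsMinimizer A 𝒟 J μ f) :
    ∃ e : Fin N → ℝ, (∀ i, HasEnergy A (f i) (e i)) ∧
      ∑ i, e i - ∑ k : Fin N, lam k ≤ N * C / μ := by
  obtain ⟨-, -, e, he, hmin⟩ := hf
  refine ⟨e, he, ?_⟩
  have h := hmin (fun k => φ k) (fun k => lam k)
    (hφ.orthonormal.comp _ Fin.val_injective)
    (fun k => by
      obtain ⟨u, hu, -⟩ := hφ.eigen k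
      exact h𝒟 (hu ▸ u.2))
    (fun k => hφ.hasEnergy k)
  rw [Finset.sum_add_distrib, Finset.sum_add_distrib] at h
  have h1 : 0 ≤ ∑ i, (1 / μ) * J (f i) :=
    Finset.sum_nonneg fun i _ => mul_nonneg (by positivity) (hJ _).1
  have h2 : ∑ k : Fin N, (1 / μ) * J (φ k) ≤ ∑ _k : Fin N, (1 / μ) * C := by
    refine Finset.sum_le_sum fun k _ => mul_le_mul_of_nonneg_left ?_ (by positivity)
    simpa [hφ.orthonormal.1 k] using (hJ (φ k)).2
  rw [Finset.sum_const, Finset.card_univ, Fintype.card_fin, nsmul_eq_mul] at h2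
  have h3 : (N : ℝ) * (1 / μ * C) = N * C / μ := by ring
  linarith

/-- For weak penalties, minimizers are close to a unitary transform of the lowest eigenvectors. -/
theorem exists_unitary_near_minimizers [CompleteSpace H] {A : H →ₗ.[𝕜] H} (hA : IsSelfAdjoint A)
    (hR : HasCompactResolvent A) {lam : ℕ → ℝ} {φ : ℕ → H} (hφ : IsEigenSystem A lam φ) {N : ℕ}
    (hgap : lam (N - 1) < lam N) {𝒟 : Set H} (h𝒟 : (A.domain : Set H) ⊆ 𝒟) {J : H → ℝ}
    (hJ : IsBoundedPenalty J) {ε : ℝ} (hε : 0 < ε) :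
    ∃ μ₀ > (0 : ℝ), ∀ μ > μ₀, ∀ f : Fin N → H, IsMinimizer A 𝒟 J μ f →
      ∃ U ∈ Matrix.unitaryGroup (Fin N) 𝕜, ∀ i, ‖f i - ∑ k : Fin N, U i k • φ k‖ < ε := by
  obtain ⟨C, hC⟩ := hJ
  obtain ⟨δ, hδ, hU⟩ := exists_unitary_near_of_defect 𝕜 H (Fin N) hε
  have hg : 0 < lam N - lam (N - 1) := sub_pos.mpr hgap
  have hgδ := mul_pos hg hδ
  -- The second entry forces the excess energy below gap times `δ`; the `1` ensures `μ > 0` without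
  -- a sign condition on `C`.
  refine ⟨max 1 (N * C / ((lam N - lam (N - 1)) * δ)), by positivity, fun μ hμ f hf => ?_⟩
  have hμ0 : 0 < μ := one_pos.trans ((le_max_left _ _).trans_lt hμ)
  obtain ⟨e, he, hle⟩ := hf.exists_energy_le hφ h𝒟 hC hμ0
  refine hU (fun k => φ k) f (hφ.orthonormal.comp _ Fin.val_injective) hf.1 ?_
  have h1 := hφ.gap_mul_defect_le hA hR hf.1 he
  have h2 : N * C / μ < (lam N - lam (N - 1)) * δ := by
    have h := (le_max_right _ _).trans_lt hμ
    rw [div_lt_iff₀ hgδ] at h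
    rw [div_lt_iff₀ hμ0]
    linarith
  rw [Fintype.card_fin]
  exact lt_of_mul_lt_mul_left ((h1.trans hle).trans_lt h2) hg.le

end Minimizers

/-- On a bounded open set the `L¹` norm is bounded by a multiple of the `L²` norm. -/
theorem isBoundedPenalty_l1Norm {𝕜 : Type*} [RCLike 𝕜] {d : ℕ}
    {Ω : TopologicalSpace.Opens (EuclideanSpace ℝ (Fin d))}
    (hΩ : Bornology.IsBounded (Ω : Set (EuclideanSpace ℝ (Fin d)))) :
    IsBoundedPenalty (l1Norm : L2 𝕜 Ω → ℝ) := by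
  have hfin : volume (Ω : Set (EuclideanSpace ℝ (Fin d))) ≠ ⊤ := hΩ.measure_lt_top.ne
  refine ⟨(volume (Ω : Set (EuclideanSpace ℝ (Fin d))) ^ (1 / 2 : ℝ)).toReal, fun g =>
    ⟨integral_nonneg fun x => norm_nonneg _, ?_⟩⟩
  have h1 : l1Norm g =
      (eLpNorm g 1 (volume.restrict (Ω : Set (EuclideanSpace ℝ (Fin d))))).toReal := by
    rw [l1Norm, eLpNorm_one_eq_lintegral_enorm,
      integral_norm_eq_lintegral_enorm (Lp.aestronglyMeasurable g)]
  -- Hölder's inequality on a set of finite volume, with exponent `1 - 1/2`.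
  have h2 := eLpNorm_le_eLpNorm_mul_rpow_measure_univ (p := 1) (q := 2) (by norm_num)
    (Lp.aestronglyMeasurable g)
  rw [Measure.restrict_apply_univ] at h2
  have hexp : (1 / (1 : ENNReal).toReal - 1 / (2 : ENNReal).toReal) = (1 / 2 : ℝ) := by norm_num
  rw [hexp] at h2
  rw [h1, Lp.norm_def, mul_comm, ← ENNReal.toReal_mul]
  exact ENNReal.toReal_mono
    (ENNReal.mul_ne_top (Lp.eLpNorm_ne_top g) (ENNReal.rpow_ne_top_of_nonneg (by norm_num) hfin)) h2

end CompressedModes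

theorem theorem1 {𝕜 : Type*} [RCLike 𝕜] {d : ℕ}
    (Ω : TopologicalSpace.Opens (EuclideanSpace ℝ (Fin d)))
    (hΩ : Bornology.IsBounded (Ω : Set (EuclideanSpace ℝ (Fin d))))
    (V : EuclideanSpace ℝ (Fin d) → ℝ)
    (A : CompressedModes.L2 𝕜 Ω →ₗ.[𝕜] CompressedModes.L2 𝕜 Ω)
    (hA : CompressedModes.IsHamiltonian V A)
    (lam : ℕ → ℝ) (φ : ℕ → CompressedModes.L2 𝕜 Ω)
    (hφ : CompressedModes.IsEigenSystem A lam φ)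
    (N : ℕ) (hN : 1 ≤ N) (hgap : lam (N - 1) < lam N)
    -- the functions admitted in the minimization: anything from the operator domain
    -- up to the form domain
    (𝒟 : Set (CompressedModes.L2 𝕜 Ω))
    (h𝒟 : (A.domain : Set (CompressedModes.L2 𝕜 Ω)) ⊆ 𝒟)
    (h𝒟' : 𝒟 ⊆ CompressedModes.formDomain A) :
    CompressedModes.IsBoundedPenalty
        (CompressedModes.l1Norm : CompressedModes.L2 𝕜 Ω → ℝ) ∧
      ∀ J : CompressedModes.L2 𝕜 Ω → ℝ, CompressedModes.IsBoundedPenalty J →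
        ∀ ε > (0 : ℝ), ∃ μ₀ > (0 : ℝ), ∀ μ > μ₀, ∀ f : Fin N → CompressedModes.L2 𝕜 Ω,
          CompressedModes.IsMinimizer A 𝒟 J μ f →
            ∃ U ∈ Matrix.unitaryGroup (Fin N) 𝕜, ∀ i,
              ‖f i - ∑ k : Fin N, U i k • φ k‖ < ε :=
  ⟨CompressedModes.isBoundedPenalty_l1Norm hΩ, fun _ hJ _ hε =>
    CompressedModes.exists_unitary_near_minimizers hA.selfAdjoint hA.compactResolvent hφ hgap h𝒟
      hJ hε⟩
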